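/- Let $\sigma_0=\mathbb 1$, $\sigma_1=\sigma_x$, $\sigma_2=\sigma_y$, $\sigma_3=\sigma_z$, and for a probability vector $p=(p_0,p_1,p_2,p_3)$ let $\Phi_p(\rho)=\sum_{i=0}^3 p_i\,\sigma_i\rho\,\sigma_i^\dagger$ be the corresponding one-qubit Pauli channel. A linear map $\mathcal L$ on complex $2\times2$ matrices is of GKLS form if $$\mathcal L(\rho)=-i[H,\rho]+\sum_{j=1}^{3}\Bigl(L_j\rho L_j^\dagger-\tfrac12L_j^\dagger L_j\rho-\tfrac12\rho L_j^\dagger L_j\Bigr)$$ for some Hermitian $H$ and some $2\times 2$ matrices $L_1,L_2,L_3$. A map $\Phi$ belongs to a dynamical semigroup if $\Phi=e^{t\mathcal L}$ for some $\mathcal L$ of GKLS form and some $t\ge 0$; it belongs to a Pauli semigroup if, moreover, $\mathcal L$ can be chosen such that $e^{s\mathcal L}$ is a Pauli channel for every $s\ge0$. A map $\Phi$ is unistochastic if there is a unitary $U\in U(4)$ with $\Phi(\rho)=\operatorname{tr}_B\bigl(U(\rho\otimes\tfrac12\mathbb 1)U^\dagger\bigr)$ for all $\rho$, where $\operatorname{tr}_B$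 is the partial trace over the second qubit. Then for every probability vector $p$: 1. $\Phi_p$ belongs to a Pauli semigroup if and only if $\Phi_p$ is unistochastic and $p_0$ is the largest component of $p$, i.e. $p_0>p_i$ for $i=1,2,3$. 2. If $\Phi_p$ belongs to any dynamical semigroup, Pauli or not, then $\Phi_p$ is unistochastic. 3. $p$ is a limit of probability vectors $q$ such that $\Phi_q$ belongs to a Pauli semigroup if and only if $\Phi_p$ is unistochastic and $p_0\ge p_i$ for all $i$. -/

import Mathlib

open scoped Matrix Kronecker

noncomputable section

/-- Complex `2 × 2` matrices, the operators on one qubit. -/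
abbrev QubitOp : Type := Matrix (Fin 2) (Fin 2) ℂ

/-- Linear maps (superoperators) on the operators of one qubit. -/
abbrev QubitMap : Type := QubitOp →ₗ[ℂ] QubitOp

/-- The matrices `σ₀ = 1`, `σ₁ = σ_x`, `σ₂ = σ_y`, `σ₃ = σ_z`. -/
def pauli : Fin 4 → QubitOp :=
  ![1, !![0, 1; 1, 0], !![0, -Complex.I; Complex.I, 0], !![1, 0; 0, -1]]

/-- The map `ρ ↦ A ρ B`. -/
def sandwich (A B : QubitOp) : QubitMap :=
  LinearMap.mulLeft ℂ A ∘ₗ LinearMap.mulRight ℂ B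

/-- The map `ρ ↦ ∑ᵢ pᵢ σᵢ ρ σᵢ†`. -/
def pauliChannel (p : Fin 4 → ℝ) : QubitMap :=
  ∑ i, (p i : ℂ) • sandwich (pauli i) (pauli i)ᴴ

/-- `Φ` is a Pauli channel: `Φ ρ = ∑ᵢ pᵢ σᵢ ρ σᵢ†` for a probability vector `p`. -/
def IsPauliChannel (Φ : QubitMap) : Prop :=
  ∃ p ∈ stdSimplex ℝ (Fin 4), Φ = pauliChannel p

/-- The Gorini–Kossakowski–Lindblad–Sudarshan generator with Hamiltonian `H` and jump operators
`L₁, L₂, L₃`: `ρ ↦ -i (H ρ - ρ H) + ∑ⱼ (Lⱼ ρ Lⱼ† - ½ Lⱼ† Lⱼ ρ - ½ ρ Lⱼ† Lⱼ)`. -/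
def gklsGenerator (H : QubitOp) (L : Fin 3 → QubitOp) : QubitMap :=
  -Complex.I • (sandwich H 1 - sandwich 1 H) +
    ∑ j, (sandwich (L j) (L j)ᴴ - (1 / 2 : ℂ) • sandwich ((L j)ᴴ * L j) 1
      - (1 / 2 : ℂ) • sandwich 1 ((L j)ᴴ * L j))

/-- `𝓛` is of GKLS form. -/
def IsGKLS (𝓛 : QubitMap) : Prop :=
  ∃ (H : QubitOp) (L : Fin 3 → QubitOp), H.IsHermitian ∧ 𝓛 = gklsGenerator H L

/-- The `4 × 4` matrix of a superoperator in the basis of matrix units. -/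
def superMatrix : QubitMap ≃ₐ[ℂ] Matrix (Fin 2 × Fin 2) (Fin 2 × Fin 2) ℂ :=
  LinearMap.toMatrixAlgEquiv (Matrix.stdBasis ℂ (Fin 2) (Fin 2))

/-- `e^{t𝓛}`; the exponential series is summed in the algebra of `4 × 4` matrices. -/
def evolution (𝓛 : QubitMap) (t : ℝ) : QubitMap :=
  superMatrix.symm (NormedSpace.exp ((t : ℂ) • superMatrix 𝓛))

/-- `Φ` is a member `e^{t𝓛}`, `t ≥ 0`, of some semigroup with generator of GKLS form. -/
def BelongsToDynamicalSemigroup (Φ : QubitMap) : Prop :=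
  ∃ 𝓛, IsGKLS 𝓛 ∧ ∃ t : ℝ, 0 ≤ t ∧ Φ = evolution 𝓛 t

/-- `Φ` is a member `e^{t𝓛}`, `t ≥ 0`, of a semigroup with generator of GKLS form all of whose
members are Pauli channels. -/
def BelongsToPauliSemigroup (Φ : QubitMap) : Prop :=
  ∃ 𝓛, IsGKLS 𝓛 ∧ (∀ s : ℝ, 0 ≤ s → IsPauliChannel (evolution 𝓛 s)) ∧
    ∃ t : ℝ, 0 ≤ t ∧ Φ = evolution 𝓛 t

/-- The partial trace over the second factor (the environment) of a two-qubit operator. -/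
def partialTraceEnv (X : Matrix (Fin 2 × Fin 2) (Fin 2 × Fin 2) ℂ) : QubitOp :=
  Matrix.of fun i j => ∑ k, X (i, k) (j, k)

/-- `Φ ρ = tr_B (U (ρ ⊗ 1/2) U†)` for some unitary `U` of order four. -/
def IsUnistochastic (Φ : QubitMap) : Prop :=
  ∃ U ∈ Matrix.unitaryGroup (Fin 2 × Fin 2) ℂ, ∀ ρ : QubitOp,
    Φ ρ = partialTraceEnv (U * (ρ ⊗ₖ ((1 / 2 : ℂ) • (1 : QubitOp))) * Uᴴ)

end

/-! A Pauli channel is diagonal in the Pauli basis, so it is described by its damping factors λ₁,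
λ₂, λ₃ on σ_x, σ_y, σ_z. All three claims pass through `DampingCondition`: λ₁λ₂λ₃ ≥ 0 and |λⱼλₖ| ≤
|λᵢ|.

For a Pauli channel this condition is equivalent to being unistochastic. It yields a factorization
λ₁ = bc, λ₂ = ca, λ₃ = ab into cosines, which a gate exp(i ∑ aₖ σₖ ⊗ σₖ) realizes
(`pauliChannel_eq_canonicalGate`). Conversely, a unitary U acts on antisymmetric matrices by A ↦ U A
Uᵀ. Three such images give vectors in ℂ³ whose pairwise cross products lie along the coordinate
axes, with lengths given by the damping factors; this forces λⱼλₖ = tλᵢ with 0 ≤ t ≤ 1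
(`real_mul_eq_of_cross_eq_single`).

For e^{t𝓛}, the diagonal g of 𝓛 in the Pauli basis satisfies gⱼ + gₖ ≤ gᵢ, and the determinant gives
λ₁λ₂λ₃ = exp(t(g₁ + g₂ + g₃)). A factor λᵢ distinct from the other two equals exp(t gᵢ), so the
inequality exponentiates; if λᵢ equals another factor, the bound |λₖ| ≤ 1 suffices
(`dampingCondition_of_dynamical`).

In a Pauli semigroup the factors are positive, being squares of those at half time; conversely,
positive factors satisfying the condition have logarithms that define nonnegative Pauli rates. The
comparison of p₀ with the other weights amounts to the signs of λⱼ + λₖ, which together with the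
condition decide positivity. Limits are handled by closedness and by mixing with the identity
channel. -/

/-! ### Pauli channels in the Pauli basis -/

/-- The factors by which the Pauli channel with weights `p` multiplies the Pauli matrices. -/
def damping (p : Fin 4 → ℝ) : Fin 4 → ℝ :=
  ![p 0 + p 1 + p 2 + p 3, p 0 + p 1 - p 2 - p 3, p 0 - p 1 + p 2 - p 3, p 0 - p 1 - p 2 + p 3]

theorem sandwich_apply (A B X : QubitOp) : sandwich A B X = A * X * B := by
  simp [sandwich, mul_assoc]

theorem pauliChannel_apply (p : Fin 4 → ℝ) (X : QubitOp) :
    pauliChannel p X = !![(p 0 + p 3) * X 0 0 + (p 1 + p 2) * X 1 1,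
      (p 0 - p 3) * X 0 1 + (p 1 - p 2) * X 1 0;
      (p 0 - p 3) * X 1 0 + (p 1 - p 2) * X 0 1,
      (p 0 + p 3) * X 1 1 + (p 1 + p 2) * X 0 0] := by
  ext i j
  fin_cases i <;> fin_cases j <;>
    simp [pauliChannel, sandwich_apply, pauli, Fin.sum_univ_four, Matrix.mul_apply,
      Matrix.vecMul, Matrix.vecHead, Matrix.vecTail] <;> ring_nf <;> simp [Complex.I_sq] <;> ring

theorem pauliChannel_pauli (p : Fin 4 → ℝ) (i : Fin 4) :
    pauliChannel p (pauli i) = (damping p i : ℂ) • pauli i := by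
  rw [pauliChannel_apply]
  ext a b
  fin_cases i <;> fin_cases a <;> fin_cases b <;> simp [pauli, damping] <;> ring

/-- Expansion of one-qubit operators in Pauli matrices. -/
noncomputable def pauliEquiv : QubitOp ≃ₗ[ℂ] (Fin 4 → ℂ) where
  toFun X i := (1 / 2) * (pauli i * X).trace
  invFun c := ∑ i, c i • pauli i
  map_add' X Y := by ext i; simp [mul_add]
  map_smul' c X := by ext i; simp; ring
  left_inv X := by
    ext i j
    fin_cases i <;> fin_cases j <;>
      simp [pauli, Fin.sum_univ_four, Matrix.trace, Matrix.mul_apply] <;> ring_nf <;>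
      simp [Complex.I_sq] <;> ring
  right_inv c := by
    ext i
    fin_cases i <;>
      simp [pauli, Fin.sum_univ_four, Matrix.trace, Matrix.mul_apply, Matrix.add_apply,
        -Matrix.cons_mul] <;> ring_nf; simp [Complex.I_sq]

/-- The Pauli matrices as a basis. -/
noncomputable def pauliBasis : Module.Basis (Fin 4) ℂ QubitOp := .ofEquivFun pauliEquiv

theorem pauliBasis_apply (i : Fin 4) : pauliBasis i = pauli i := by
  simp [pauliBasis, pauliEquiv, Pi.single_apply]

theorem pauliBasis_repr (X : QubitOp) (i : Fin 4) :
    pauliBasis.repr X i = (1 / 2) * (pauli i * X).trace := rfl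

theorem qubitMap_ext {Φ Ψ : QubitMap} (h : ∀ i, Φ (pauli i) = Ψ (pauli i)) : Φ = Ψ :=
  pauliBasis.ext fun i => by simpa [pauliBasis_apply] using h i

theorem pauli_ne_zero (i : Fin 4) : pauli i ≠ 0 := by
  rw [← pauliBasis_apply]
  exact pauliBasis.ne_zero i

theorem det_pauliChannel (p : Fin 4 → ℝ) :
    LinearMap.det (pauliChannel p) = ((∏ i, damping p i : ℝ) : ℂ) := by
  have h : LinearMap.toMatrix pauliBasis pauliBasis (pauliChannel p) =
      Matrix.diagonal fun i => (damping p i : ℂ) := by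
    ext i j
    rw [LinearMap.toMatrix_apply, pauliBasis_apply, pauliChannel_pauli, ← pauliBasis_apply]
    rw [map_smul, Finsupp.smul_apply, Module.Basis.repr_self, Finsupp.single_apply,
      Matrix.diagonal_apply]
    by_cases h : i = j <;> simp [h, eq_comm (a := j)]
  rw [← LinearMap.det_toMatrix pauliBasis, h, Matrix.det_diagonal]
  simp

theorem trace_eq_sum_repr (Φ : QubitMap) :
    LinearMap.trace ℂ QubitOp Φ = ∑ i, pauliBasis.repr (Φ (pauli i)) i := by
  rw [LinearMap.trace_eq_matrix_trace ℂ pauliBasis]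
  simp [Matrix.trace, LinearMap.toMatrix_apply, pauliBasis_apply]

-- Determinants of exponentials and semigroup evolution

attribute [local instance] Matrix.linftyOpNormedRing Matrix.linftyOpNormedAlgebra in
theorem Matrix.differentiable_det {n : Type*} [Fintype n] [DecidableEq n] :
    Differentiable ℂ (Matrix.det : Matrix n n ℂ → ℂ) := by
  have h : ∀ i j, Differentiable ℂ fun M : Matrix n n ℂ => M i j := fun i j =>
    (LinearMap.toContinuousLinearMap
      (Matrix.entryLinearMap ℂ ℂ i j)).differentiable
  have e : (Matrix.det : Matrix n n ℂ → ℂ) =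
      fun M => ∑ σ : Equiv.Perm n, ((Equiv.Perm.sign σ : ℤ) : ℂ) * ∏ i, M (σ i) i := by
    funext M
    exact Matrix.det_apply' M
  rw [e]
  fun_prop

attribute [local instance] Matrix.linftyOpNormedRing Matrix.linftyOpNormedAlgebra in
theorem Matrix.hasDerivAt_det_of_eq_one {n : Type*} [Fintype n] [DecidableEq n]
    {f : ℂ → Matrix n n ℂ} {A : Matrix n n ℂ} {z : ℂ} (hf : HasDerivAt f A z) (h : f z = 1) :
    HasDerivAt (fun w => (f w).det) A.trace z := by
  have hd : HasFDerivAt (Matrix.det : Matrix n n ℂ → ℂ)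
      (fderiv ℂ (Matrix.det : Matrix n n ℂ → ℂ) 1) 1 := (Matrix.differentiable_det 1).hasFDerivAt
  have h1 : HasDerivAt (fun z : ℂ => (1 : Matrix n n ℂ) + z • A) A 0 :=
    (((hasDerivAt_id (0 : ℂ)).smul_const A).const_add 1).congr_deriv (one_smul ℂ A)
  have h2 := hd.comp_hasDerivAt_of_eq (0 : ℂ) h1 (by simp)
  set q := (Matrix.det (1 + (Polynomial.X : Polynomial ℂ) • A.map Polynomial.C)).divX.divX
  have h3 : Matrix.det ∘ (fun z : ℂ => (1 : Matrix n n ℂ) + z • A) =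
      fun z => 1 + A.trace * z + q.eval z * z ^ 2 :=
    funext fun z => Matrix.det_one_add_smul z A
  rw [h3] at h2
  have h4 := (((hasDerivAt_id (0 : ℂ)).const_mul A.trace).const_add 1).add
    ((q.hasDerivAt 0).mul ((hasDerivAt_id (0 : ℂ)).pow 2))
  exact (hd.comp_hasDerivAt_of_eq z hf h.symm).congr_deriv ((h2.unique h4).trans (by simp))

-- Writing exp(wA) = exp((w - z)A) exp(zA) moves the derivative at z to the identity matrix, so the
-- determinant solves f' = (tr A) f. Its product with exp(-z tr A) is therefore constant.
attribute [local instance] Matrix.linftyOpNormedRing Matrix.linftyOpNormedAlgebra in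
theorem Matrix.det_exp_smul {n : Type*} [Fintype n] [DecidableEq n] (A : Matrix n n ℂ) (z : ℂ) :
    (NormedSpace.exp (z • A)).det = Complex.exp (z * A.trace) := by
  have h : ∀ z : ℂ, HasDerivAt (fun z : ℂ => (NormedSpace.exp (z • A)).det)
      (A.trace * (NormedSpace.exp (z • A)).det) z := fun z => by
    have h0 : HasDerivAt (fun w : ℂ => (NormedSpace.exp ((w - z) • A))) A z := by
      have h00 := hasDerivAt_exp_smul_const (𝕂 := ℂ) A 0
      have h01 := HasDerivAt.scomp_of_eq z h00 ((hasDerivAt_id z).sub_const z) (by simp)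
      exact h01.congr_deriv (by simp)
    have h1 := Matrix.hasDerivAt_det_of_eq_one h0 (by simp)
    refine (h1.mul_const (NormedSpace.exp (z • A)).det).congr_of_eventuallyEq (.of_forall fun w => ?_)
    simp only [← Matrix.det_mul]
    rw [← Matrix.exp_add_of_commute]
    · congr 2
      rw [← add_smul, sub_add_cancel]
    · exact ((Commute.refl A).smul_left _).smul_right _
  have h2 : ∀ z : ℂ, HasDerivAt
      (fun z : ℂ => (NormedSpace.exp (z • A)).det * Complex.exp (-(z * A.trace))) 0 z := fun z => by
    have e := ((hasDerivAt_id z).mul_const A.trace).neg.cexp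
    have := (h z).mul e
    refine this.congr_deriv ?_
    simp
    ring
  have h3 := is_const_of_deriv_eq_zero (fun z => (h2 z).differentiableAt) (fun z => (h2 z).deriv) z 0
  simp only [zero_smul, NormedSpace.exp_zero, Matrix.det_one, zero_mul, neg_zero,
    Complex.exp_zero, mul_one] at h3
  rw [Complex.exp_neg] at h3
  exact (eq_div_of_mul_eq (inv_ne_zero (Complex.exp_ne_zero _)) h3).trans (by simp)

attribute [local instance] Matrix.linftyOpNormedRing Matrix.linftyOpNormedAlgebra in
theorem evolution_apply_of_eigen {𝓛 : QubitMap} {X : QubitOp} {c : ℂ} (h : 𝓛 X = c • X) (t : ℝ) :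
    evolution 𝓛 t X = Complex.exp (t * c) • X := by
  have h1 := NormedSpace.exp_series_hasSum_exp' (𝕂 := ℂ) ((t : ℂ) • superMatrix 𝓛)
  let f : Matrix (Fin 2 × Fin 2) (Fin 2 × Fin 2) ℂ →ₗ[ℂ] QubitOp :=
    LinearMap.applyₗ X ∘ₗ superMatrix.symm.toLinearMap
  have h2 := (LinearMap.toContinuousLinearMap f).hasSum h1
  have h3 : HasSum (fun n : ℕ => ((n.factorial : ℂ)⁻¹ • ((t : ℂ) * c) ^ n) • X)
      (Complex.exp (t * c) • X) := by
    rw [Complex.exp_eq_exp_ℂ]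
    exact (NormedSpace.exp_series_hasSum_exp' (𝕂 := ℂ) ((t : ℂ) * c)).smul_const X
  have h4 : ∀ n : ℕ, (𝓛 ^ n) X = c ^ n • X := fun n => by
    induction n with
    | zero => simp
    | succ n ih => rw [pow_succ', Module.End.mul_apply, ih, map_smul, h, smul_smul, pow_succ]
  have h5 : (fun n : ℕ => LinearMap.toContinuousLinearMap f
      ((n.factorial : ℂ)⁻¹ • ((t : ℂ) • superMatrix 𝓛) ^ n)) =
      fun n : ℕ => ((n.factorial : ℂ)⁻¹ • ((t : ℂ) * c) ^ n) • X := by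
    funext n
    generalize (t : ℂ) = τ
    simp [f, smul_pow, h4, smul_smul, mul_pow, mul_assoc]
  rw [h5] at h2
  exact h2.unique h3

theorem evolution_add (𝓛 : QubitMap) (s t : ℝ) :
    evolution 𝓛 (s + t) = evolution 𝓛 s * evolution 𝓛 t := by
  rw [evolution, evolution, evolution, ← map_mul, ← Matrix.exp_add_of_commute]
  · rw [← add_smul]; push_cast; rfl
  · exact ((Commute.refl _).smul_left _).smul_right _

attribute [local instance] Matrix.linftyOpNormedRing Matrix.linftyOpNormedAlgebra in
theorem commute_evolution (𝓛 : QubitMap) (t : ℝ) : Commute 𝓛 (evolution 𝓛 t) := by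
  have h : Commute (superMatrix 𝓛) (NormedSpace.exp ((t : ℂ) • superMatrix 𝓛)) :=
    ((Commute.refl (superMatrix 𝓛)).smul_right _).exp_right
  simpa [evolution] using h.map superMatrix.symm

theorem det_evolution (𝓛 : QubitMap) (t : ℝ) :
    LinearMap.det (evolution 𝓛 t) = Complex.exp (t * LinearMap.trace ℂ QubitOp 𝓛) := by
  have h1 : LinearMap.det (evolution 𝓛 t) = (superMatrix (evolution 𝓛 t)).det :=
    (LinearMap.det_toMatrix (Matrix.stdBasis ℂ (Fin 2) (Fin 2)) _).symm
  have h2 : LinearMap.trace ℂ QubitOp 𝓛 = (superMatrix 𝓛).trace :=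
    LinearMap.trace_eq_matrix_trace ℂ (Matrix.stdBasis ℂ (Fin 2) (Fin 2)) 𝓛
  rw [h1, h2, evolution, AlgEquiv.apply_symm_apply, Matrix.det_exp_smul]

/-! ### Damping factors in dynamical semigroups -/

/-- The inequalities satisfied by the damping factors of unistochastic Pauli channels. -/
def DampingCondition (x y z : ℝ) : Prop :=
  0 ≤ x * y * z ∧ |y * z| ≤ |x| ∧ |z * x| ≤ |y| ∧ |x * y| ≤ |z|

theorem abs_damping_le_one {p : Fin 4 → ℝ} (hp : p ∈ stdSimplex ℝ (Fin 4)) (i : Fin 4) :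
    |damping p i| ≤ 1 := by
  obtain ⟨h0, h1⟩ := hp
  rw [Fin.sum_univ_four] at h1
  have a := h0 0
  have b := h0 1
  have c := h0 2
  have d := h0 3
  fin_cases i <;> simp [damping, abs_le] <;> constructor <;> linarith

theorem damping_zero {p : Fin 4 → ℝ} (hp : p ∈ stdSimplex ℝ (Fin 4)) : damping p 0 = 1 := by
  have h1 := hp.2
  rwa [Fin.sum_univ_four] at h1

/-- Generators of GKLS form map into traceless matrices, by cyclicity of the trace. -/
theorem repr_gklsGenerator_zero (H : QubitOp) (L : Fin 3 → QubitOp) (X : QubitOp) :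
    pauliBasis.repr (gklsGenerator H L X) 0 = 0 := by
  have h (A : QubitOp) : (A * X * Aᴴ).trace = (Aᴴ * A * X).trace := Matrix.trace_mul_cycle _ _ _
  have h' (A : QubitOp) : (X * (Aᴴ * A)).trace = (Aᴴ * A * X).trace := Matrix.trace_mul_comm _ _
  simp [pauliBasis_repr, pauli, gklsGenerator, sandwich_apply, Fin.sum_univ_three,
    h, h', Matrix.trace_mul_comm X H]
  ring

/-- The diagonal entries, in the Pauli basis, of the dissipator of one jump operator. -/
theorem repr_dissipator (A : QubitOp) (i : Fin 4) :
    pauliBasis.repr (A * pauli i * Aᴴ - (1 / 2 : ℂ) • (Aᴴ * A * pauli i)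
      - (1 / 2 : ℂ) • (pauli i * (Aᴴ * A))) i =
      ((∑ k, (damping (Pi.single k 1) i - 1) * Complex.normSq (pauliBasis.repr A k) : ℝ) : ℂ) := by
  fin_cases i <;>
  · simp [pauliBasis_repr, pauli, damping, Matrix.trace, Matrix.mul_apply, Fin.sum_univ_four,
      Matrix.conjTranspose_apply, Complex.ext_iff, Complex.normSq, -Matrix.cons_mul]
    try ring_nf
    try simp

/-- The diagonal entries of a generator of GKLS form in the Pauli basis. -/
theorem repr_gklsGenerator_self (H : QubitOp) (L : Fin 3 → QubitOp) (i : Fin 4) :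
    pauliBasis.repr (gklsGenerator H L (pauli i)) i =
      ((∑ j, ∑ k, (damping (Pi.single k 1) i - 1) *
        Complex.normSq (pauliBasis.repr (L j) k) : ℝ) : ℂ) := by
  have h : pauliBasis.repr (H * pauli i - pauli i * H) i = 0 := by
    rw [pauliBasis_repr, mul_sub, Matrix.trace_sub, ← mul_assoc, Matrix.trace_mul_comm, sub_self,
      mul_zero]
  have h2 : gklsGenerator H L (pauli i) = -Complex.I • (H * pauli i - pauli i * H) +
      ∑ j, (L j * pauli i * (L j)ᴴ - (1 / 2 : ℂ) • ((L j)ᴴ * L j * pauli i)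
        - (1 / 2 : ℂ) • (pauli i * ((L j)ᴴ * L j))) := by
    simp [gklsGenerator, sandwich_apply, LinearMap.sum_apply]
  rw [h2, map_add, map_smul, map_sum, Finsupp.add_apply, Finsupp.smul_apply, h,
    Finsupp.finsetSum_apply, smul_zero, zero_add, Complex.ofReal_sum]
  exact Finset.sum_congr rfl fun j _ => repr_dissipator (L j) i

/-- The diagonal entries are real and each is at least the sum of the other two. -/
theorem IsGKLS.exists_diagonal {𝓛 : QubitMap} (h : IsGKLS 𝓛) :
    ∃ g : Fin 4 → ℝ, (∀ i, pauliBasis.repr (𝓛 (pauli i)) i = g i) ∧ g 0 = 0 ∧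
      g 2 + g 3 ≤ g 1 ∧ g 3 + g 1 ≤ g 2 ∧ g 1 + g 2 ≤ g 3 := by
  obtain ⟨H, L, -, rfl⟩ := h
  refine ⟨_, repr_gklsGenerator_self H L, ?_, ?_, ?_, ?_⟩
  · simp [damping, Fin.sum_univ_four]
  -- The weight nₖ of a jump operator on σₖ contributes -2nₖ to gᵢ exactly when σₖ and σᵢ
  -- anticommute. Each jump operator thus contributes 4nᵢ ≥ 0 to gᵢ - gⱼ - gₖ.
  all_goals
    rw [← Finset.sum_add_distrib]
    refine Finset.sum_le_sum fun j _ => ?_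
    have h1 := Complex.normSq_nonneg (pauliBasis.repr (L j) 1)
    have h2 := Complex.normSq_nonneg (pauliBasis.repr (L j) 2)
    have h3 := Complex.normSq_nonneg (pauliBasis.repr (L j) 3)
    simp [damping, Fin.sum_univ_four]
    linarith

/-- The determinant of an exponential is nonzero, and here it is the product of the damping factors.
-/
theorem damping_ne_zero_of_evolution {p : Fin 4 → ℝ} {𝓛 : QubitMap} {t : ℝ}
    (h : pauliChannel p = evolution 𝓛 t) (i : Fin 4) : damping p i ≠ 0 := by
  have h1 := det_evolution 𝓛 t
  rw [← h, det_pauliChannel] at h1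
  have h2 : ((∏ i, damping p i : ℝ) : ℂ) ≠ 0 := h1 ▸ Complex.exp_ne_zero _
  exact Finset.prod_ne_zero_iff.mp (by exact_mod_cast h2) i (Finset.mem_univ i)

theorem repr_pauliChannel (p : Fin 4 → ℝ) (X : QubitOp) (j : Fin 4) :
    pauliBasis.repr (pauliChannel p X) j = damping p j * pauliBasis.repr X j := by
  have h : pauliBasis.coord j ∘ₗ pauliChannel p = (damping p j : ℂ) • pauliBasis.coord j := by
    refine pauliBasis.ext fun i => ?_
    rw [LinearMap.comp_apply, pauliBasis_apply, pauliChannel_pauli, map_smul, LinearMap.smul_apply,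
      ← pauliBasis_apply, Module.Basis.coord_apply, Module.Basis.repr_self, Finsupp.single_apply]
    split_ifs with hij <;> simp [hij]
  exact LinearMap.congr_fun h X

/-- A generator of a semigroup through a Pauli channel preserves the Pauli matrices with simple
damping factor. -/
theorem apply_pauli_of_evolution {p : Fin 4 → ℝ} {𝓛 : QubitMap} {t : ℝ}
    (h : pauliChannel p = evolution 𝓛 t) {i : Fin 4}
    (h0 : pauliBasis.repr (𝓛 (pauli i)) 0 = 0)
    (hi : ∀ j, j ≠ 0 → j ≠ i → damping p j ≠ damping p i) :
    𝓛 (pauli i) = pauliBasis.repr (𝓛 (pauli i)) i • pauli i := by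
  -- Since 𝓛 commutes with its exponential, the σⱼ-component of 𝓛 σᵢ is annihilated by λⱼ - λᵢ. The
  -- component along the identity is excluded by `h0` instead.
  have hc : pauliChannel p (𝓛 (pauli i)) = 𝓛 (pauliChannel p (pauli i)) := by
    rw [h]
    exact (LinearMap.congr_fun (commute_evolution 𝓛 t).eq (pauli i)).symm
  apply pauliBasis.repr.injective
  ext j
  rw [map_smul, ← pauliBasis_apply, Module.Basis.repr_self, pauliBasis_apply]
  by_cases hj : j = i
  · simp [hj]
  by_cases hj0 : j = 0
  · subst hj0
    simp [h0, Ne.symm hj]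
  have h3 := congrArg (fun Y => pauliBasis.repr Y j) hc
  simp only [repr_pauliChannel, pauliChannel_pauli, map_smul, Finsupp.smul_apply, smul_eq_mul] at h3
  have h4 : ((damping p j : ℂ) - damping p i) ≠ 0 :=
    sub_ne_zero.mpr (by exact_mod_cast hi j hj0 hj)
  have h5 : pauliBasis.repr (𝓛 (pauli i)) j = 0 :=
    (mul_eq_zero.mp ((sub_mul _ _ _).trans (sub_eq_zero.mpr h3))).resolve_left h4
  simp [h5, Ne.symm hj]

/-- With coinciding damping factors 𝓛 need not be diagonal, so λᵢ = exp(t gᵢ) may fail; the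
determinant identity holds regardless. -/
theorem dampingCondition_of_dynamical {p : Fin 4 → ℝ} (hp : p ∈ stdSimplex ℝ (Fin 4))
    (h : BelongsToDynamicalSemigroup (pauliChannel p)) :
    DampingCondition (damping p 1) (damping p 2) (damping p 3) := by
  obtain ⟨𝓛, hL, t, ht, h⟩ := h
  obtain ⟨g, hg, hg0, hg1, hg2, hg3⟩ := hL.exists_diagonal
  have hdet : damping p 1 * damping p 2 * damping p 3 = Real.exp (t * (g 1 + g 2 + g 3)) := by
    have h1 := det_evolution 𝓛 t
    rw [← h, det_pauliChannel, trace_eq_sum_repr] at h1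
    simp only [hg, Fin.sum_univ_four, Fin.prod_univ_four, damping_zero hp, hg0] at h1
    have h2 : (((1 * damping p 1 * damping p 2 * damping p 3 : ℝ)) : ℂ) =
        ((Real.exp (t * (g 1 + g 2 + g 3)) : ℝ) : ℂ) := by
      rw [h1]; push_cast; simp
    have h3 := Complex.ofReal_injective h2
    linarith
  have hz (i : Fin 4) : pauliBasis.repr (𝓛 (pauli i)) 0 = 0 := by
    obtain ⟨H, L, -, rfl⟩ := hL
    exact repr_gklsGenerator_zero H L _
  have hiso (i : Fin 4) (hi : ∀ j, j ≠ 0 → j ≠ i → damping p j ≠ damping p i) :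
      damping p i = Real.exp (t * g i) := by
    have h1 := evolution_apply_of_eigen (apply_pauli_of_evolution h (hz i) hi) t
    rw [← h, pauliChannel_pauli, hg] at h1
    have h2 := smul_left_injective ℂ (pauli_ne_zero i) h1
    apply Complex.ofReal_injective
    rw [h2]
    push_cast
    rfl
  -- If x equals y or z, the bound by 1 on the remaining factor is enough. Otherwise x = exp(ta)
  -- divides out of the determinant, leaving yz = exp(t(b + c)) ≤ exp(ta).
  have key (x y z a b c : ℝ) (hy : |y| ≤ 1) (hz : |z| ≤ 1)
      (hd : x * y * z = Real.exp (t * (a + b + c))) (hbc : b + c ≤ a) (hx : y ≠ x → z ≠ x → x = Real.exp (t * a)) : |y * z| ≤ |x| := by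
    rw [abs_mul]
    by_cases h1 : y = x
    · subst h1
      exact mul_le_of_le_one_right (abs_nonneg _) hz
    by_cases h2 : z = x
    · subst h2
      exact mul_le_of_le_one_left (abs_nonneg _) hy
    have h3 := hx h1 h2
    have h4 : y * z = Real.exp (t * (b + c)) := by
      rw [add_assoc, mul_add t a, Real.exp_add, ← h3, mul_assoc] at hd
      exact mul_left_cancel₀ (h3 ▸ (Real.exp_pos _).ne') hd
    rw [← abs_mul, h4, h3, abs_of_pos (Real.exp_pos _), abs_of_pos (Real.exp_pos _)]
    exact Real.exp_le_exp.mpr (mul_le_mul_of_nonneg_left hbc ht)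
  have hle := abs_damping_le_one hp
  have h231 : damping p 2 * damping p 3 * damping p 1 = Real.exp (t * (g 2 + g 3 + g 1)) := by
    rw [← mul_rotate, ← add_rotate, hdet]
  have h312 : damping p 3 * damping p 1 * damping p 2 = Real.exp (t * (g 3 + g 1 + g 2)) := by
    rw [mul_rotate, add_rotate, hdet]
  have hpair (i j k : Fin 4) (hijk : ∀ l, l ≠ 0 → l ≠ i → l = j ∨ l = k)
      (hj : damping p j ≠ damping p i) (hk : damping p k ≠ damping p i) (l : Fin 4) (hl : l ≠ 0)
      (hli : l ≠ i) : damping p l ≠ damping p i := by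
    rcases hijk l hl hli with rfl | rfl <;> assumption
  refine ⟨hdet ▸ (Real.exp_pos _).le,
    key _ _ _ (g 1) (g 2) (g 3) (hle 2) (hle 3) hdet hg1 fun h1 h2 =>
      hiso 1 (hpair 1 2 3 (by decide) h1 h2),
    key _ _ _ (g 2) (g 3) (g 1) (hle 3) (hle 1) h231 hg2 fun h1 h2 =>
      hiso 2 (hpair 2 3 1 (by decide) h1 h2),
    key _ _ _ (g 3) (g 1) (g 2) (hle 1) (hle 2) h312 hg3 fun h1 h2 =>
      hiso 3 (hpair 3 1 2 (by decide) h1 h2)⟩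

/-! ### Realizing Pauli channels by two-qubit gates -/

theorem exists_cos_sin_half (θ : ℝ) : ∃ c s : ℝ, c ^ 2 + s ^ 2 = 1 ∧ c ^ 2 - s ^ 2 = Real.cos θ :=
  ⟨Real.cos (θ / 2), Real.sin (θ / 2), Real.cos_sq_add_sin_sq _, by
    rw [← Real.cos_two_mul', mul_div_cancel₀ _ two_ne_zero]⟩

/-- The unitary `exp (i ∑ aₖ σₖ ⊗ σₖ)` in the computational basis, up to parametrization. -/
noncomputable def canonicalGate (c₁ s₁ c₂ s₂ : ℝ) (w : ℂ) :
    Matrix (Fin 2 × Fin 2) (Fin 2 × Fin 2) ℂ :=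
  Matrix.of fun i j =>
    if i.1 = i.2 then
      if i = j then w * c₁ else if j.1 = j.2 then Complex.I * w * s₁ else 0
    else
      if i = j then star w * c₂ else if j.1 = j.2 then 0 else Complex.I * star w * s₂

theorem canonicalGate_mem_unitaryGroup {c₁ s₁ c₂ s₂ : ℝ} {w : ℂ} (h1 : c₁ ^ 2 + s₁ ^ 2 = 1)
    (h2 : c₂ ^ 2 + s₂ ^ 2 = 1) (hw : w * star w = 1) :
    canonicalGate c₁ s₁ c₂ s₂ w ∈ Matrix.unitaryGroup (Fin 2 × Fin 2) ℂ := by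
  have h1' : (c₁ : ℂ) ^ 2 + s₁ ^ 2 = 1 := by exact_mod_cast h1
  have h2' : (c₂ : ℂ) ^ 2 + s₂ ^ 2 = 1 := by exact_mod_cast h2
  have hI := Complex.I_sq
  rw [Matrix.mem_unitaryGroup_iff]
  simp only [Complex.star_def] at hw
  ext ⟨i, i'⟩ ⟨j, j'⟩
  rw [Matrix.mul_apply, Fintype.sum_prod_type]
  fin_cases i <;> fin_cases i' <;> fin_cases j <;> fin_cases j' <;>
    simp [canonicalGate, Matrix.star_apply] <;>
    first
    | ring1
    | linear_combination (c₁ ^ 2 + s₁ ^ 2 : ℂ) * hw + h1' - w * (starRingEnd ℂ) w * (s₁ : ℂ) ^ 2 * hI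
    | linear_combination (c₂ ^ 2 + s₂ ^ 2 : ℂ) * hw + h2' - w * (starRingEnd ℂ) w * (s₂ : ℂ) ^ 2 * hI

/-- For angles θ and φ with cosines c₁, c₂ and sines s₁, s₂, the damping factors are the pairwise
products of cos(θ + φ), cos(θ - φ) and the real part a² - b² of the squared phase. -/
theorem pauliChannel_eq_canonicalGate {p : Fin 4 → ℝ} {c₁ s₁ c₂ s₂ a b : ℝ}
    (h1 : c₁ ^ 2 + s₁ ^ 2 = 1) (h2 : c₂ ^ 2 + s₂ ^ 2 = 1) (hw : a ^ 2 + b ^ 2 = 1)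
    (e0 : p 0 + p 1 + p 2 + p 3 = 1)
    (e1 : p 0 + p 1 - p 2 - p 3 = (a ^ 2 - b ^ 2) * (c₁ * c₂ + s₁ * s₂))
    (e2 : p 0 - p 1 + p 2 - p 3 = (a ^ 2 - b ^ 2) * (c₁ * c₂ - s₁ * s₂))
    (e3 : p 0 - p 1 - p 2 + p 3 = (c₁ * c₂ + s₁ * s₂) * (c₁ * c₂ - s₁ * s₂)) (ρ : QubitOp) :
    pauliChannel p ρ = partialTraceEnv (canonicalGate c₁ s₁ c₂ s₂ ⟨a, b⟩ *
      (ρ ⊗ₖ ((1 / 2 : ℂ) • (1 : QubitOp))) * (canonicalGate c₁ s₁ c₂ s₂ ⟨a, b⟩)ᴴ) := by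
  have hh : p 0 + p 3 = (c₁ ^ 2 + c₂ ^ 2) / 2 := by
    linear_combination e0 / 2 + e3 / 2 + (c₂ ^ 2 - 1) / 2 * h1 - s₁ ^ 2 / 2 * h2
  have hh' : p 1 + p 2 = (s₁ ^ 2 + s₂ ^ 2) / 2 := by linear_combination e0 - hh - h1 / 2 - h2 / 2
  have hd : p 0 - p 3 = (a ^ 2 - b ^ 2) * (c₁ * c₂) := by linear_combination e1 / 2 + e2 / 2
  have hd' : p 1 - p 2 = (a ^ 2 - b ^ 2) * (s₁ * s₂) := by linear_combination e1 / 2 - e2 / 2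
  rw [pauliChannel_apply]
  have H1 : (p 0 : ℂ) + p 3 = (c₁ ^ 2 + c₂ ^ 2) / 2 := by exact_mod_cast hh
  have H2 : (p 1 : ℂ) + p 2 = (s₁ ^ 2 + s₂ ^ 2) / 2 := by exact_mod_cast hh'
  have H3 : (p 0 : ℂ) - p 3 = (a ^ 2 - b ^ 2) * (c₁ * c₂) := by exact_mod_cast hd
  have H4 : (p 1 : ℂ) - p 2 = (a ^ 2 - b ^ 2) * (s₁ * s₂) := by exact_mod_cast hd'
  rw [H1, H2, H3, H4]
  have hw' : (a : ℂ) ^ 2 + b ^ 2 = 1 := by exact_mod_cast hw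
  have hI := Complex.I_sq
  have ew : (⟨a, b⟩ : ℂ) = a + b * Complex.I := Complex.mk_eq_add_mul_I a b
  rw [ew]
  have m : (a + b * Complex.I) * (a - b * Complex.I) = 1 := by
    linear_combination hw' - b ^ 2 * hI
  have m2 : (a + b * Complex.I) ^ 2 + (a - b * Complex.I) ^ 2 = 2 * (a ^ 2 - b ^ 2) := by
    linear_combination 2 * b ^ 2 * hI
  have es : star (a + b * Complex.I) = (a - b * Complex.I : ℂ) := by simp [sub_eq_add_neg]
  have es' : (starRingEnd ℂ) (a + b * Complex.I) = (a - b * Complex.I : ℂ) := es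
  unfold canonicalGate
  rw [es]
  have es2 : (starRingEnd ℂ) (a - b * Complex.I) = (a + b * Complex.I : ℂ) := by simp
  -- From here the phase and its conjugate are free symbols `w`, `v`, tied only by wv = 1 and the
  -- value of w² + v².
  generalize (a + b * Complex.I : ℂ) = w at *
  generalize (a - b * Complex.I : ℂ) = v at *
  ext i j
  fin_cases i <;> fin_cases j <;>
    simp [partialTraceEnv, Matrix.mul_apply, Fintype.sum_prod_type, Matrix.kroneckerMap_apply,
      Matrix.one_apply, es', es2]
  · linear_combination -((c₁ ^ 2 + c₂ ^ 2) / 2 * ρ 0 0 + (s₁ ^ 2 + s₂ ^ 2) / 2 * ρ 1 1 : ℂ) * m +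
      (s₁ ^ 2 + s₂ ^ 2) / 2 * ρ 1 1 * w * v * hI
  · linear_combination -(c₁ * c₂ * ρ 0 1 + s₁ * s₂ * ρ 1 0 : ℂ) / 2 * m2 +
      s₁ * s₂ * ρ 1 0 / 2 * (w ^ 2 + v ^ 2) * hI
  · linear_combination -(c₁ * c₂ * ρ 1 0 + s₁ * s₂ * ρ 0 1 : ℂ) / 2 * m2 +
      s₁ * s₂ * ρ 0 1 / 2 * (w ^ 2 + v ^ 2) * hI
  · linear_combination -((c₁ ^ 2 + c₂ ^ 2) / 2 * ρ 1 1 + (s₁ ^ 2 + s₂ ^ 2) / 2 * ρ 0 0 : ℂ) * m +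
      (s₁ ^ 2 + s₂ ^ 2) / 2 * ρ 0 0 * w * v * hI

theorem exists_factors_of_dampingCondition {x y z : ℝ} (h : DampingCondition x y z)
    (hx : |x| ≤ 1) (hy : |y| ≤ 1) (hz : |z| ≤ 1) :
    ∃ a b c : ℝ, |a| ≤ 1 ∧ |b| ≤ 1 ∧ |c| ≤ 1 ∧ x = b * c ∧ y = c * a ∧ z = a * b := by
  obtain ⟨h0, h1, h2, h3⟩ := h
  by_cases h4 : x * y * z = 0
  -- If one factor vanishes, its inequality makes the product of the other two vanish as well.
  · have : (y = 0 ∧ z = 0) ∨ (z = 0 ∧ x = 0) ∨ (x = 0 ∧ y = 0) := by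
      rcases mul_eq_zero.mp h4 with h5 | rfl
      · rcases mul_eq_zero.mp h5 with rfl | rfl
        · simp [-abs_mul] at h1; tauto
        · simp [-abs_mul] at h2; tauto
      · simp [-abs_mul] at h3; tauto
    rcases this with ⟨rfl, rfl⟩ | ⟨rfl, rfl⟩ | ⟨rfl, rfl⟩
    · exact ⟨0, x, 1, by simp [hx]⟩
    · exact ⟨1, 0, y, by simp [hy]⟩
    · exact ⟨z, 1, 0, by simp [hz]⟩
  · have hx0 : x ≠ 0 := by rintro rfl; simp at h4
    have hy0 : y ≠ 0 := by rintro rfl; simp at h4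
    have hz0 : z ≠ 0 := by rintro rfl; simp at h4
    have hs := Real.mul_self_sqrt h0
    have hb (u v : ℝ) (hu : u ≠ 0) (h : |v| ≤ |u|) (e : x * y * z = u * v) :
        |Real.sqrt (x * y * z) / u| ≤ 1 := by
      rw [← sq_le_one_iff_abs_le_one, div_pow, Real.sq_sqrt h0, div_le_one (by positivity), e]
      nlinarith [abs_mul_abs_self u, le_abs_self (u * v), abs_mul u v, abs_nonneg u]
    -- The equations force a² = yz/x and its cyclic analogues; dividing one common root √(xyz) by x,
    -- y, z makes the signs consistent.
    refine ⟨√(x * y * z) / x, √(x * y * z) / y, √(x * y * z) / z, hb x _ hx0 h1 (by ring),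
      hb y _ hy0 h2 (by ring), hb z _ hz0 h3 (by ring), ?_, ?_, ?_⟩ <;>
    · rw [div_mul_div_comm, hs]
      field_simp

theorem isUnistochastic_of_dampingCondition {p : Fin 4 → ℝ} (hp : p ∈ stdSimplex ℝ (Fin 4))
    (h : DampingCondition (damping p 1) (damping p 2) (damping p 3)) :
    IsUnistochastic (pauliChannel p) := by
  have hle := abs_damping_le_one hp
  obtain ⟨a, b, c, ha, hb, hc, e1, e2, e3⟩ :=
    exists_factors_of_dampingCondition h (hle 1) (hle 2) (hle 3)
  rw [abs_le] at ha hb hc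
  obtain ⟨u, v, huv, huv'⟩ := exists_cos_sin_half (Real.arccos c)
  rw [Real.cos_arccos hc.1 hc.2] at huv'
  have hw : (⟨u, v⟩ : ℂ) * star (⟨u, v⟩ : ℂ) = 1 := by
    rw [Complex.star_def, Complex.mul_conj]
    exact_mod_cast (by simpa [Complex.normSq, sq] using huv)
  -- The angles are chosen so that θ + φ = arccos a and θ - φ = arccos b.
  set θ := (Real.arccos a + Real.arccos b) / 2
  set φ := (Real.arccos a - Real.arccos b) / 2
  have hs : Real.cos θ * Real.cos φ - Real.sin θ * Real.sin φ = a := by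
    rw [← Real.cos_add, show θ + φ = Real.arccos a by ring, Real.cos_arccos ha.1 ha.2]
  have hd : Real.cos θ * Real.cos φ + Real.sin θ * Real.sin φ = b := by
    rw [← Real.cos_sub, show θ - φ = Real.arccos b by ring, Real.cos_arccos hb.1 hb.2]
  refine ⟨canonicalGate (Real.cos θ) (Real.sin θ) (Real.cos φ) (Real.sin φ) ⟨u, v⟩,
    canonicalGate_mem_unitaryGroup (Real.cos_sq_add_sin_sq θ) (Real.cos_sq_add_sin_sq φ) hw,
    fun ρ => pauliChannel_eq_canonicalGate (Real.cos_sq_add_sin_sq θ) (Real.cos_sq_add_sin_sq φ)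
      huv (damping_zero hp) ?_ ?_ ?_ ρ⟩
  · rw [huv', hd, mul_comm c]; exact e1
  · rw [huv', hs]; exact e2
  · rw [hs, hd, mul_comm b]; exact e3

/-! ### Necessity of the damping condition: antisymmetric matrices -/

/-- The hypotheses are components of x × ȳ = r₃e₃, y × z̄ = r₁e₁ and z × x̄ = r₂e₂. A cross product
is orthogonal to its factors, so nonzero r₂ and r₃ force x to be a multiple of e₁ and y₃ to vanish;
then r₂r₃ = |x₁|²r₁. -/
theorem real_mul_eq_of_cross_eq_single {x₁ x₂ x₃ y₁ y₂ y₃ z₁ z₂ z₃ : ℂ} {r₁ r₂ r₃ : ℝ}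
    (hx : ‖x₁‖ ≤ 1)
    (a₁ : x₂ * star y₃ - x₃ * star y₂ = 0) (a₂ : x₃ * star y₁ - x₁ * star y₃ = 0)
    (a₃ : x₁ * star y₂ - x₂ * star y₁ = r₃)
    (b₁ : y₂ * star z₃ - y₃ * star z₂ = r₁) (b₂ : y₃ * star z₁ - y₁ * star z₃ = 0)
    (c₁ : z₂ * star x₃ - z₃ * star x₂ = 0) (c₂ : z₃ * star x₁ - z₁ * star x₃ = r₂)
    (c₃ : z₁ * star x₂ - z₂ * star x₁ = 0) :
    ∃ t : ℝ, 0 ≤ t ∧ t ≤ 1 ∧ r₂ * r₃ = t * r₁ := by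
  by_cases h2 : r₂ = 0
  · exact ⟨0, le_rfl, zero_le_one, by simp [h2]⟩
  by_cases h3 : r₃ = 0
  · exact ⟨0, le_rfl, zero_le_one, by simp [h3]⟩
  have h2' : (r₂ : ℂ) ≠ 0 := by exact_mod_cast h2
  have h3' : (r₃ : ℂ) ≠ 0 := by exact_mod_cast h3
  have hx3 : x₃ = 0 := (mul_eq_zero.mp
    (by linear_combination -x₃ * a₃ - x₂ * a₂ - x₁ * a₁ : x₃ * (r₃ : ℂ) = 0)).resolve_right h3'
  have hy3 : star y₃ = 0 := (mul_eq_zero.mp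
    (by linear_combination -star y₃ * a₃ - star y₂ * a₂ - star y₁ * a₁ :
      star y₃ * (r₃ : ℂ) = 0)).resolve_right h3'
  have hx2 : star x₂ = 0 := (mul_eq_zero.mp
    (by linear_combination -star x₃ * c₃ - star x₂ * c₂ - star x₁ * c₁ :
      star x₂ * (r₂ : ℂ) = 0)).resolve_right h2'
  rw [star_eq_zero] at hx2 hy3
  subst hx2 hx3 hy3
  refine ⟨‖x₁‖ ^ 2, by positivity, pow_le_one₀ (norm_nonneg _) hx, ?_⟩
  apply Complex.ofReal_injective
  have hn : ((‖x₁‖ ^ 2 : ℝ) : ℂ) = x₁ * star x₁ := by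
    rw [Complex.star_def, Complex.mul_conj, Complex.normSq_eq_norm_sq]
  have b₁' := congrArg star b₁
  simp only [star_zero, mul_zero, zero_mul, sub_zero, star_mul', Complex.star_def,
    Complex.conj_ofReal, Complex.conj_conj] at *
  rw [Complex.ofReal_mul, Complex.ofReal_mul, hn, ← b₁', ← c₂, ← a₃]
  ring

theorem dampingCondition_of_real_mul_eq {x y z a b c : ℝ} (ha : 0 ≤ a) (ha' : a ≤ 1)
    (hb : 0 ≤ b) (hb' : b ≤ 1) (hc : 0 ≤ c) (hc' : c ≤ 1)
    (h1 : y * z = a * x) (h2 : z * x = b * y) (h3 : x * y = c * z) : DampingCondition x y z := by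
  refine ⟨by rw [h3]; nlinarith [mul_self_nonneg z], ?_, ?_, ?_⟩
  · rw [h1, abs_mul, abs_of_nonneg ha]; exact mul_le_of_le_one_left (abs_nonneg _) ha'
  · rw [h2, abs_mul, abs_of_nonneg hb]; exact mul_le_of_le_one_left (abs_nonneg _) hb'
  · rw [h3, abs_mul, abs_of_nonneg hc]; exact mul_le_of_le_one_left (abs_nonneg _) hc'

/-- The real basis `ε = i σ_y` of antisymmetric matrices of order two. -/
def epsilon : QubitOp := !![0, 1; -1, 0]

/-- The antisymmetric two-qubit matrices that transform as a vector under rotations of the first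
qubit: `-i (σₐ σ_y) ⊗ σ_y`. -/
def antisymVector : Fin 3 → Matrix (Fin 2 × Fin 2) (Fin 2 × Fin 2) ℂ :=
  ![pauli 3 ⊗ₖ epsilon, (-Complex.I) • (pauli 0 ⊗ₖ epsilon), -(pauli 1 ⊗ₖ epsilon)]

/-- The components of an antisymmetric two-qubit matrix along `antisymVector`. -/
noncomputable def antisymCoord (X : Matrix (Fin 2 × Fin 2) (Fin 2 × Fin 2) ℂ) : Fin 3 → ℂ :=
  ![(X (0, 0) (0, 1) - X (1, 0) (1, 1)) / 2, Complex.I * (X (0, 0) (0, 1) + X (1, 0) (1, 1)) / 2,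
    -(X (0, 0) (1, 1) + X (1, 0) (0, 1)) / 2]

/-- An antisymmetric matrix is a combination of `antisymVector` plus a term ε ⊗ S with S symmetric.
The latter drops out: mixed terms vanish because tr(εSᴴ) = 0, and two such terms leave a multiple of
the identity, orthogonal to the Pauli matrices. The vector parts multiply by the cross product. -/
theorem trace_pauli_partialTraceEnv {X Y : Matrix (Fin 2 × Fin 2) (Fin 2 × Fin 2) ℂ}
    (hX : Xᵀ = -X) (hY : Yᵀ = -Y) (a : Fin 3) :
    (pauli a.succ * partialTraceEnv (X * Yᴴ)).trace = 4 * Complex.I *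
      (antisymCoord X (a + 1) * star (antisymCoord Y (a + 2)) -
        antisymCoord X (a + 2) * star (antisymCoord Y (a + 1))) := by
  have hX' (i j) : X i j = - X j i := congrFun (congrFun hX j) i
  have hY' (i j) : Y i j = - Y j i := congrFun (congrFun hY j) i
  have hX0 (i) : X i i = 0 := self_eq_neg.mp (hX' i i)
  have hY0 (i) : Y i i = 0 := self_eq_neg.mp (hY' i i)
  fin_cases a <;>
    simp [pauli, Matrix.trace, Matrix.mul_apply, partialTraceEnv, antisymCoord,
      Fintype.sum_prod_type, -Matrix.cons_mul, hX0, hY0, hX' (0, 1) (0, 0), hX' (1, 0) (0, 0),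
      hX' (1, 1) (0, 0), hX' (1, 0) (0, 1), hX' (1, 1) (0, 1), hX' (1, 1) (1, 0),
      hY' (0, 1) (0, 0), hY' (1, 0) (0, 0), hY' (1, 1) (0, 0), hY' (1, 0) (0, 1),
      hY' (1, 1) (0, 1), hY' (1, 1) (1, 0)] <;>
    ring_nf <;> simp [Complex.I_sq] <;> ring

theorem antisymVector_transpose (a : Fin 3) : (antisymVector a)ᵀ = -antisymVector a := by
  ext ⟨i, i'⟩ ⟨j, j'⟩
  fin_cases a <;> fin_cases i <;> fin_cases i' <;> fin_cases j <;> fin_cases j' <;>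
    simp [antisymVector, pauli, epsilon]

theorem antisymVector_mul_conjTranspose (a : Fin 3) :
    antisymVector (a + 1) * (antisymVector (a + 2))ᴴ =
      Complex.I • (pauli a.succ ⊗ₖ (1 : QubitOp)) := by
  ext ⟨i, i'⟩ ⟨j, j'⟩
  fin_cases a <;> fin_cases i <;> fin_cases i' <;> fin_cases j <;> fin_cases j' <;>
    simp [antisymVector, pauli, epsilon, Matrix.mul_apply, Fintype.sum_prod_type]

theorem antisymVector_mem_unitaryGroup (a : Fin 3) :
    antisymVector a ∈ Matrix.unitaryGroup (Fin 2 × Fin 2) ℂ := by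
  rw [Matrix.mem_unitaryGroup_iff]
  ext ⟨i, i'⟩ ⟨j, j'⟩
  fin_cases a <;> fin_cases i <;> fin_cases i' <;> fin_cases j <;> fin_cases j' <;>
    simp [antisymVector, pauli, epsilon, Matrix.mul_apply, Fintype.sum_prod_type,
      Matrix.star_apply]

theorem norm_antisymCoord_le_one {X : Matrix (Fin 2 × Fin 2) (Fin 2 × Fin 2) ℂ}
    (hX : X ∈ Matrix.unitaryGroup (Fin 2 × Fin 2) ℂ) (a : Fin 3) : ‖antisymCoord X a‖ ≤ 1 := by
  have h := entry_norm_bound_of_unitary hX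
  have h1 := h (0, 0) (0, 1)
  have h2 := h (1, 0) (1, 1)
  have h3 := h (0, 0) (1, 1)
  have h4 := h (1, 0) (0, 1)
  have h5 := norm_sub_le (X (0, 0) (0, 1)) (X (1, 0) (1, 1))
  have h6 := norm_add_le (X (0, 0) (0, 1)) (X (1, 0) (1, 1))
  have h7 := norm_add_le (X (0, 0) (1, 1)) (X (1, 0) (0, 1))
  fin_cases a <;> simp [antisymCoord, -neg_add_rev] <;> linarith

theorem dampingCondition_of_isUnistochastic {p : Fin 4 → ℝ}
    (h : IsUnistochastic (pauliChannel p)) :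
    DampingCondition (damping p 1) (damping p 2) (damping p 3) := by
  obtain ⟨U, hU, h⟩ := h
  set X : Fin 3 → Matrix (Fin 2 × Fin 2) (Fin 2 × Fin 2) ℂ := fun a => U * antisymVector a * Uᵀ
    with hXdef
  have hXt (a : Fin 3) : (X a)ᵀ = -X a := by
    simp [hXdef, antisymVector_transpose, Matrix.transpose_mul, mul_assoc]
  have hUt : Uᵀ ∈ Matrix.unitaryGroup (Fin 2 × Fin 2) ℂ :=
    Matrix.transpose_mem_unitaryGroup_iff.mpr hU
  have hXu (a : Fin 3) : X a ∈ Matrix.unitaryGroup (Fin 2 × Fin 2) ℂ :=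
    mul_mem (mul_mem hU (antisymVector_mem_unitaryGroup a)) hUt
  -- The inner factor Uᵀ(Uᵀ)ᴴ cancels, so these products are σₐ ⊗ 1 conjugated by U, exactly what
  -- the channel traces out.
  have hXX (a : Fin 3) : X (a + 1) * (X (a + 2))ᴴ =
      (2 * Complex.I) • (U * (pauli a.succ ⊗ₖ ((1 / 2 : ℂ) • (1 : QubitOp))) * Uᴴ) := by
    have h1 : Uᵀ * (Uᵀ)ᴴ = 1 := Matrix.mem_unitaryGroup_iff.mp hUt
    calc X (a + 1) * (X (a + 2))ᴴ
        = U * antisymVector (a + 1) * (Uᵀ * (Uᵀ)ᴴ) * (antisymVector (a + 2))ᴴ * Uᴴ := by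
          simp only [hXdef, Matrix.conjTranspose_mul, mul_assoc]
      _ = U * (antisymVector (a + 1) * (antisymVector (a + 2))ᴴ) * Uᴴ := by
          rw [h1, mul_one, mul_assoc U]
      _ = _ := by
          rw [antisymVector_mul_conjTranspose, Matrix.kronecker_smul]
          simp [smul_smul]
          congr 1
          ring
  -- Since the channel multiplies each Pauli matrix by its damping factor, the cross product of the
  -- two coordinate vectors is that factor times a basis vector.
  have hcross (l a : Fin 3) :
      antisymCoord (X (l + 1)) (a + 1) * star (antisymCoord (X (l + 2)) (a + 2)) -
        antisymCoord (X (l + 1)) (a + 2) * star (antisymCoord (X (l + 2)) (a + 1)) =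
      if a = l then (damping p l.succ : ℂ) else 0 := by
    have h1 := trace_pauli_partialTraceEnv (hXt (l + 1)) (hXt (l + 2)) a
    have h2 (c : ℂ) (Y : Matrix (Fin 2 × Fin 2) (Fin 2 × Fin 2) ℂ) :
        partialTraceEnv (c • Y) = c • partialTraceEnv Y := by
      ext i j
      simp [partialTraceEnv, mul_add]
    have h3 : (pauli a.succ * pauli l.succ).trace = if a = l then 2 else 0 := by
      have h4 := pauliBasis_repr (pauli l.succ) a.succ
      rw [← pauliBasis_apply l.succ, Module.Basis.repr_self, pauliBasis_apply,
        Finsupp.single_apply] at h4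
      simp only [Fin.succ_inj, eq_comm (a := l)] at h4
      split_ifs at h4 ⊢ <;> linear_combination -2 * h4
    rw [hXX, h2, ← h, pauliChannel_pauli, Matrix.mul_smul, Matrix.mul_smul, Matrix.trace_smul,
      Matrix.trace_smul, h3] at h1
    refine mul_left_cancel₀ (mul_ne_zero (by norm_num : (4 : ℂ) ≠ 0) Complex.I_ne_zero)
      (h1.symm.trans ?_)
    split_ifs <;> simp; ring
  -- Addition in `Fin 3` is cyclic, so one argument covers all three inequalities.
  have key (m : Fin 3) : ∃ t : ℝ, 0 ≤ t ∧ t ≤ 1 ∧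
      damping p (m + 1).succ * damping p (m + 2).succ = t * damping p m.succ := by
    have e3 : m + 2 + 1 = m := by rw [add_assoc]; exact add_zero m
    have e4 : m + 2 + 2 = m + 1 := by rw [add_assoc]; rfl
    have e2 : m + 1 + 1 = m + 2 := by rw [add_assoc]; rfl
    have e5 : m + 1 + 2 = m := by rw [add_assoc]; exact add_zero m
    have n1 : m + 1 ≠ m := by revert m; decide
    have n2 : m + 2 ≠ m := by revert m; decide
    have n3 : m + 2 ≠ m + 1 := by revert m; decide
    apply real_mul_eq_of_cross_eq_single (norm_antisymCoord_le_one (hXu m) m)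
    · simpa [e2, e3, e4, e5, n1, n2, n3, n1.symm, n2.symm, n3.symm] using hcross (m + 2) m
    · simpa [e2, e3, e4, e5, n1, n2, n3, n1.symm, n2.symm, n3.symm] using hcross (m + 2) (m + 1)
    · simpa [e2, e3, e4, e5, n1, n2, n3, n1.symm, n2.symm, n3.symm] using hcross (m + 2) (m + 2)
    · simpa [e2, e3, e4, e5, n1, n2, n3, n1.symm, n2.symm, n3.symm] using hcross m m
    · simpa [e2, e3, e4, e5, n1, n2, n3, n1.symm, n2.symm, n3.symm] using hcross m (m + 1)
    · simpa [e2, e3, e4, e5, n1, n2, n3, n1.symm, n2.symm, n3.symm] using hcross (m + 1) m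
    · simpa [e2, e3, e4, e5, n1, n2, n3, n1.symm, n2.symm, n3.symm] using hcross (m + 1) (m + 1)
    · simpa [e2, e3, e4, e5, n1, n2, n3, n1.symm, n2.symm, n3.symm] using hcross (m + 1) (m + 2)
  obtain ⟨a, ha, ha', h1⟩ := key 0
  obtain ⟨b, hb, hb', h2⟩ := key 1
  obtain ⟨c, hc, hc', h3⟩ := key 2
  exact dampingCondition_of_real_mul_eq ha ha' hb hb' hc hc' h1 h2 h3

theorem isUnistochastic_pauliChannel_iff {p : Fin 4 → ℝ} (hp : p ∈ stdSimplex ℝ (Fin 4)) :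
    IsUnistochastic (pauliChannel p) ↔
      DampingCondition (damping p 1) (damping p 2) (damping p 3) :=
  ⟨dampingCondition_of_isUnistochastic, isUnistochastic_of_dampingCondition hp⟩

/-! ### Pauli semigroups and the dominance of p₀ -/

/-- This rests on λ₂ + λ₃ = 2(p₀ - p₁) and its cyclic analogues. -/
theorem forall_lt_zero_iff (p : Fin 4 → ℝ) :
    (∀ i, i ≠ 0 → p i < p 0) ↔ 0 < damping p 2 + damping p 3 ∧ 0 < damping p 3 + damping p 1 ∧
      0 < damping p 1 + damping p 2 := by
  simp only [damping, Fin.forall_fin_succ]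
  simp [-and_congr_right_iff]
  constructor <;> rintro ⟨h1, h2, h3⟩ <;> refine ⟨?_, ?_, ?_⟩ <;> linarith

theorem forall_le_zero_iff (p : Fin 4 → ℝ) :
    (∀ i, p i ≤ p 0) ↔ 0 ≤ damping p 2 + damping p 3 ∧ 0 ≤ damping p 3 + damping p 1 ∧
      0 ≤ damping p 1 + damping p 2 := by
  simp only [damping, Fin.forall_fin_succ]
  simp [-and_congr_right_iff]
  constructor <;> rintro ⟨h1, h2, h3⟩ <;> refine ⟨?_, ?_, ?_⟩ <;> linarith

/-- The weights of the Pauli channel with given damping factors. -/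
noncomputable def pauliWeights (x y z : ℝ) : Fin 4 → ℝ :=
  ![(1 + x + y + z) / 4, (1 + x - y - z) / 4, (1 - x + y - z) / 4, (1 - x - y + z) / 4]

theorem damping_pauliWeights (x y z : ℝ) : damping (pauliWeights x y z) = ![1, x, y, z] := by
  ext i
  fin_cases i <;> simp [damping, pauliWeights] <;> ring

/-- The weights other than the first are nonnegative since 1 + x - y - z ≥ 1 + yz - y - z = (1 -
y)(1 - z), and cyclically. -/
theorem pauliWeights_mem_stdSimplex {x y z : ℝ} (hx : 0 ≤ x) (hy : 0 ≤ y) (hz : 0 ≤ z)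
    (hx' : x ≤ 1) (hy' : y ≤ 1) (hz' : z ≤ 1) (h1 : y * z ≤ x) (h2 : z * x ≤ y) (h3 : x * y ≤ z) :
    pauliWeights x y z ∈ stdSimplex ℝ (Fin 4) := by
  have e1 := mul_nonneg (sub_nonneg.mpr hy') (sub_nonneg.mpr hz')
  have e2 := mul_nonneg (sub_nonneg.mpr hz') (sub_nonneg.mpr hx')
  have e3 := mul_nonneg (sub_nonneg.mpr hx') (sub_nonneg.mpr hy')
  constructor
  · intro i
    fin_cases i <;> simp [pauliWeights] <;> linarith
  · simp [Fin.sum_univ_four, pauliWeights]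
    ring

/-- Each jump operator satisfies LᴴL = γ·1, so the anticommutator terms only subtract the total rate
from the weight of the identity. The generator is thus diagonal in the Pauli basis. -/
theorem gklsGenerator_smul_pauli {γ : Fin 3 → ℝ} (h : ∀ j, 0 ≤ γ j) :
    gklsGenerator 0 (fun j => (√(γ j) : ℂ) • pauli j.succ) =
      pauliChannel ![-(γ 0 + γ 1 + γ 2), γ 0, γ 1, γ 2] := by
  have hs (j) : (√(γ j) : ℂ) * (√(γ j) : ℂ) = γ j := by exact_mod_cast Real.mul_self_sqrt (h j)
  have hu (i) : (pauli i)ᴴ * pauli i = 1 := by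
    ext a b
    fin_cases i <;> fin_cases a <;> fin_cases b <;> simp [pauli, Matrix.mul_apply]
  refine LinearMap.ext fun X => ?_
  simp only [gklsGenerator, pauliChannel, LinearMap.add_apply, LinearMap.smul_apply,
    LinearMap.sub_apply, sandwich_apply, Matrix.conjTranspose_smul,
    Matrix.smul_mul, Matrix.mul_smul, hu, smul_smul, Complex.star_def, Complex.conj_ofReal, hs,
    Fin.sum_univ_three, Fin.sum_univ_four]
  simp [pauli]
  module

theorem BelongsToPauliSemigroup.of_damping {p : Fin 4 → ℝ} (hp : p ∈ stdSimplex ℝ (Fin 4))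
    (hx : 0 < damping p 1) (hy : 0 < damping p 2) (hz : 0 < damping p 3)
    (h1 : damping p 2 * damping p 3 ≤ damping p 1) (h2 : damping p 3 * damping p 1 ≤ damping p 2)
    (h3 : damping p 1 * damping p 2 ≤ damping p 3) : BelongsToPauliSemigroup (pauliChannel p) := by
  have hle := abs_damping_le_one hp
  have h0 := damping_zero hp
  have l1 := Real.log_nonpos hx.le (abs_le.mp (hle 1)).2
  have l2 := Real.log_nonpos hy.le (abs_le.mp (hle 2)).2
  have l3 := Real.log_nonpos hz.le (abs_le.mp (hle 3)).2
  replace h1 := Real.log_le_log (mul_pos hy hz) h1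
  replace h2 := Real.log_le_log (mul_pos hz hx) h2
  replace h3 := Real.log_le_log (mul_pos hx hy) h3
  rw [Real.log_mul hy.ne' hz.ne'] at h1
  rw [Real.log_mul hz.ne' hx.ne'] at h2
  rw [Real.log_mul hx.ne' hy.ne'] at h3
  have ex := Real.exp_log hx
  have ey := Real.exp_log hy
  have ez := Real.exp_log hz
  generalize Real.log (damping p 1) = a at *
  generalize Real.log (damping p 2) = b at *
  generalize Real.log (damping p 3) = c at *
  -- These rates solve -2(γ 1 + γ 2) = a and its cyclic analogues; they are nonnegative by the
  -- logarithms of the product inequalities.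
  let γ : Fin 3 → ℝ := ![(a - b - c) / 4, (b - c - a) / 4, (c - a - b) / 4]
  have hγ (j) : 0 ≤ γ j := by fin_cases j <;> simp [γ] <;> linarith
  let q : Fin 4 → ℝ := ![-(γ 0 + γ 1 + γ 2), γ 0, γ 1, γ 2]
  have hq : damping q = ![0, a, b, c] := by
    ext i
    fin_cases i <;> simp [damping, q, γ] <;> ring
  have hev (s : ℝ) (i : Fin 4) : evolution (pauliChannel q) s (pauli i) =
      ((Real.exp (s * damping q i) : ℝ) : ℂ) • pauli i := by
    rw [evolution_apply_of_eigen (pauliChannel_pauli q i)]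
    push_cast
    rfl
  refine ⟨pauliChannel q, ⟨0, _, Matrix.isHermitian_zero, (gklsGenerator_smul_pauli hγ).symm⟩,
    fun s hs => ⟨pauliWeights (Real.exp (s * a)) (Real.exp (s * b)) (Real.exp (s * c)), ?_, ?_⟩,
    1, zero_le_one, ?_⟩
  · have hm {u v : ℝ} (h : u ≤ v) : Real.exp (s * u) ≤ Real.exp (s * v) :=
      Real.exp_le_exp.mpr (mul_le_mul_of_nonneg_left h hs)
    have hn {u : ℝ} (h : u ≤ 0) : Real.exp (s * u) ≤ 1 := by simpa using hm h
    refine pauliWeights_mem_stdSimplex (Real.exp_pos _).le (Real.exp_pos _).le (Real.exp_pos _).le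
      (hn l1) (hn l2) (hn l3) ?_ ?_ ?_ <;>
    · rw [← Real.exp_add, ← mul_add]
      exact hm ‹_›
  · refine qubitMap_ext fun i => ?_
    rw [hev, pauliChannel_pauli, damping_pauliWeights, hq]
    fin_cases i <;> simp
  · refine qubitMap_ext fun i => ?_
    rw [hev, pauliChannel_pauli, hq]
    fin_cases i <;> simp [h0, ← ex, ← ey, ← ez]

/-- The member at time t/2 is itself a Pauli channel, so each factor is the square of a real number,
nonzero by the determinant. -/
theorem damping_pos_of_pauliSemigroup {p : Fin 4 → ℝ}
    (h : BelongsToPauliSemigroup (pauliChannel p)) (i : Fin 4) : 0 < damping p i := by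
  obtain ⟨𝓛, -, hP, t, ht, h⟩ := h
  obtain ⟨q, -, hq⟩ := hP (t / 2) (by positivity)
  have h1 : damping p i = damping q i ^ 2 := by
    have h2 : (damping p i : ℂ) • pauli i = ((damping q i : ℂ) * damping q i) • pauli i := by
      rw [← pauliChannel_pauli, h, ← add_halves t, evolution_add, Module.End.mul_apply, hq,
        pauliChannel_pauli, map_smul, pauliChannel_pauli, smul_smul]
    have h3 := smul_left_injective ℂ (pauli_ne_zero i) h2
    rw [sq]
    exact_mod_cast h3
  rw [h1]
  exact sq_pos_of_ne_zero (damping_ne_zero_of_evolution hq.symm i)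

theorem BelongsToPauliSemigroup.belongsToDynamicalSemigroup {Φ : QubitMap}
    (h : BelongsToPauliSemigroup Φ) : BelongsToDynamicalSemigroup Φ :=
  let ⟨𝓛, hL, _, ht⟩ := h
  ⟨𝓛, hL, ht⟩

theorem DampingCondition.nonneg {x y z : ℝ} (h : DampingCondition x y z) (h1 : 0 ≤ y + z)
    (h2 : 0 ≤ z + x) (h3 : 0 ≤ x + y) : 0 ≤ x ∧ 0 ≤ y ∧ 0 ≤ z := by
  obtain ⟨h0, e1, e2, e3⟩ := h
  have key {x y z : ℝ} (h0 : 0 ≤ x * y * z) (h2 : 0 ≤ z + x) (h3 : 0 ≤ x + y) : 0 ≤ x := by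
    -- If x < 0, the pairwise sums make y and z positive, contradicting xyz ≥ 0.
    by_contra! hx
    have := mul_pos (show 0 < y by linarith) (show 0 < z by linarith)
    nlinarith
  exact ⟨key h0 h2 h3, key (by linarith [h0, mul_rotate x y z] : 0 ≤ y * z * x) h3 h1,
    key (by linarith [h0, mul_rotate x y z, mul_rotate y z x] : 0 ≤ z * x * y) h1 h2⟩

theorem DampingCondition.pos {x y z : ℝ} (h : DampingCondition x y z) (h1 : 0 < y + z)
    (h2 : 0 < z + x) (h3 : 0 < x + y) : 0 < x ∧ 0 < y ∧ 0 < z := by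
  obtain ⟨hx, hy, hz⟩ := h.nonneg h1.le h2.le h3.le
  obtain ⟨-, e1, e2, e3⟩ := h
  have key {x y z : ℝ} (hx : 0 ≤ x) (e : |y * z| ≤ |x|) (h2 : 0 < z + x) (h3 : 0 < x + y) :
      0 < x := by
    refine hx.lt_of_ne ?_
    rintro rfl
    have := mul_pos (show 0 < y by linarith) (show 0 < z by linarith)
    rw [abs_of_pos this, abs_zero] at e
    linarith
  exact ⟨key hx e1 h2 h3, key hy e2 h3 h1, key hz e3 h1 h2⟩

theorem belongsToPauliSemigroup_iff {p : Fin 4 → ℝ} (hp : p ∈ stdSimplex ℝ (Fin 4)) :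
    BelongsToPauliSemigroup (pauliChannel p) ↔
      IsUnistochastic (pauliChannel p) ∧ ∀ i, i ≠ 0 → p i < p 0 := by
  rw [isUnistochastic_pauliChannel_iff hp, forall_lt_zero_iff]
  constructor
  · intro h
    have hpos := damping_pos_of_pauliSemigroup h
    exact ⟨dampingCondition_of_dynamical hp h.belongsToDynamicalSemigroup,
      add_pos (hpos 2) (hpos 3), add_pos (hpos 3) (hpos 1), add_pos (hpos 1) (hpos 2)⟩
  · rintro ⟨h, h1, h2, h3⟩
    obtain ⟨hx, hy, hz⟩ := h.pos h1 h2 h3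
    obtain ⟨-, e1, e2, e3⟩ := h
    rw [abs_of_pos hx] at e1
    rw [abs_of_pos hy] at e2
    rw [abs_of_pos hz] at e3
    exact .of_damping hp hx hy hz (le_of_abs_le e1) (le_of_abs_le e2) (le_of_abs_le e3)

/-! ### The closure of the Pauli semigroup channels -/

theorem continuous_damping (i : Fin 4) : Continuous fun p => damping p i := by
  fin_cases i <;> simp [damping] <;> fun_prop

/-- The left side equals (1 - ε)yz + ε - ε(1 - ε)(1 - y)(1 - z). -/
theorem mixture_mul_le {x y z ε : ℝ} (hε : 0 ≤ ε) (hε' : ε ≤ 1) (hy : y ≤ 1) (hz : z ≤ 1)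
    (h : y * z ≤ x) :
    ((1 - ε) * y + ε) * ((1 - ε) * z + ε) ≤ (1 - ε) * x + ε := by
  have h1 := mul_le_mul_of_nonneg_left h (sub_nonneg.mpr hε')
  have h2 := mul_nonneg (mul_nonneg (sub_nonneg.mpr hε') hε)
    (mul_nonneg (sub_nonneg.mpr hy) (sub_nonneg.mpr hz))
  linarith

theorem mem_closure_pauliSemigroup_iff {p : Fin 4 → ℝ} (hp : p ∈ stdSimplex ℝ (Fin 4)) :
    p ∈ closure {q | q ∈ stdSimplex ℝ (Fin 4) ∧ BelongsToPauliSemigroup (pauliChannel q)} ↔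
      IsUnistochastic (pauliChannel p) ∧ ∀ i, p i ≤ p 0 := by
  rw [isUnistochastic_pauliChannel_iff hp]
  constructor
  · intro h
    have hc := continuous_damping
    have hclosed : IsClosed {q : Fin 4 → ℝ |
        DampingCondition (damping q 1) (damping q 2) (damping q 3) ∧ ∀ i, q i ≤ q 0} := by
      simp only [DampingCondition, Set.ofPred_and, Set.ofPred_forall]
      have h1 := hc 1
      have h2 := hc 2
      have h3 := hc 3
      refine (((isClosed_le (by fun_prop) (by fun_prop)).inter
        ((isClosed_le (by fun_prop) (by fun_prop)).inter
        ((isClosed_le (by fun_prop) (by fun_prop)).inter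
        (isClosed_le (by fun_prop) (by fun_prop)))))).inter
        (isClosed_iInter fun i => isClosed_le (by fun_prop) (by fun_prop))
    refine closure_minimal ?_ hclosed h
    rintro q ⟨hq, hqs⟩
    have h1 := (belongsToPauliSemigroup_iff hq).mp hqs
    refine ⟨(isUnistochastic_pauliChannel_iff hq).mp h1.1, fun i => ?_⟩
    by_cases hi : i = 0
    · rw [hi]
    · exact (h1.2 i hi).le
  · rintro ⟨h, h'⟩
    rw [forall_le_zero_iff] at h'
    obtain ⟨hx, hy, hz⟩ := h.nonneg h'.1 h'.2.1 h'.2.2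
    obtain ⟨-, e1, e2, e3⟩ := h
    rw [abs_of_nonneg hx] at e1
    rw [abs_of_nonneg hy] at e2
    rw [abs_of_nonneg hz] at e3
    have hle (i) := (abs_le.mp (abs_damping_le_one hp i)).2
    -- Mixing with the identity channel replaces each factor λ by (1 - ε)λ + ε, which is strictly
    -- positive and preserves the product inequalities.
    let f : ℝ → Fin 4 → ℝ := fun ε => (1 - ε) • p + ε • Pi.single 0 1
    have hf : Filter.Tendsto f (nhdsWithin 0 (Set.Ioi 0)) (nhds p) := by
      have : Continuous f := by fun_prop
      have h0 : f 0 = p := by simp [f]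
      exact (h0 ▸ this.tendsto 0).mono_left nhdsWithin_le_nhds
    refine mem_closure_of_tendsto hf ?_
    filter_upwards [Ioo_mem_nhdsGT (zero_lt_one' ℝ)] with ε hε
    have hfs : f ε ∈ stdSimplex ℝ (Fin 4) :=
      convex_stdSimplex ℝ (Fin 4) hp (single_mem_stdSimplex ℝ 0) (by linarith [hε.2]) hε.1.le
        (by ring)
    have hd (i) : damping (f ε) i = (1 - ε) * damping p i + ε := by
      fin_cases i <;> simp [f, damping] <;> ring
    have hpos {u : ℝ} (hu : 0 ≤ u) : 0 < (1 - ε) * u + ε :=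
      add_pos_of_nonneg_of_pos (mul_nonneg (by linarith [hε.2]) hu) hε.1
    refine ⟨hfs, .of_damping hfs ?_ ?_ ?_ ?_ ?_ ?_⟩ <;> simp only [hd]
    · exact hpos hx
    · exact hpos hy
    · exact hpos hz
    · exact mixture_mul_le hε.1.le hε.2.le (hle 2) (hle 3) (le_of_abs_le e1)
    · exact mixture_mul_le hε.1.le hε.2.le (hle 3) (hle 1) (le_of_abs_le e2)
    · exact mixture_mul_le hε.1.le hε.2.le (hle 1) (hle 2) (le_of_abs_le e3)

theorem mainTheorem1 (p : Fin 4 → ℝ) (hp : p ∈ stdSimplex ℝ (Fin 4)) :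
    (BelongsToPauliSemigroup (pauliChannel p) ↔
      IsUnistochastic (pauliChannel p) ∧ ∀ i, i ≠ 0 → p i < p 0) ∧
    (BelongsToDynamicalSemigroup (pauliChannel p) → IsUnistochastic (pauliChannel p)) ∧
    (p ∈ closure {q | q ∈ stdSimplex ℝ (Fin 4) ∧ BelongsToPauliSemigroup (pauliChannel q)} ↔
      IsUnistochastic (pauliChannel p) ∧ ∀ i, p i ≤ p 0) :=
  ⟨belongsToPauliSemigroup_iff hp,
    fun h => isUnistochastic_of_dampingCondition hp (dampingCondition_of_dynamical hp h),
    mem_closure_pauliSemigroup_iff hp⟩
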